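/- Let the prototile be the right triangle with legs $1$ and $2$ and hypotenuse $\sqrt5$. The pinwheel dissection cuts a triangle similar to it, with right angle at $C$, short leg $CA$ and long leg $CB$, into five triangles similar to it with ratio $1/\sqrt5$: if $D=\tfrac{4A+B}{5}$, $E=\tfrac{2A+3B}{5}$, $F=\tfrac{B+C}{2}$ and $G=\tfrac{C+D}{2}$, these are $ACD$, $CFG$, $DFG$, $DEF$ and $BEF$. A level-$n$ supertile ($n\ge 0$) is the set of $5^n$ triangles obtained by applying this dissection $n$ times to a triangle congruent (reflections allowed) to the prototile scaled by $(\sqrt5)^n$. A pinwheel tiling is a tiling of the plane by triangles congruent (reflections allowed) to the prototile such that every finite set of its tiles is contained in a supertile of some level. Let $P$ be a pinwheel tiling, viewed as an infinite planar graph: its vertices are all corners of the tiles, and its edges are the segments into which these points divide the sides of the tiles (two distinct vertices are adjacent if and only if they lie on a common side of some tile and no vertex lies strictly between them). Then the chromatic index of $P$, that is, the least number of colours in a colouring of the edges in which any two distinct edges with a common endpoint receive different colours, is $\chi'(P)=8$. -/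

import Mathlib

namespace Pinwheel

/-- A right triangle in the plane `ℂ`, given by its three labelled corners: the corner `right` at the
right angle, the other end `short` of the short leg, and the other end `long` of the long leg. -/
@[ext]
structure Triangle where
  right : ℂ
  short : ℂ
  long : ℂ

namespace Triangle

/-- The set of the three corners. -/
def corners (T : Triangle) : Set ℂ := {T.right, T.short, T.long}

/-- The three sides: short leg, long leg, hypotenuse. -/
def sides (T : Triangle) : Set (Set ℂ) :=
  {segment ℝ T.right T.short, segment ℝ T.right T.long, segment ℝ T.short T.long}

/-- The closed triangular region. -/
def region (T : Triangle) : Set ℂ := convexHull ℝ T.corners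

/-- `T` is congruent (reflections allowed) to the prototile scaled by the factor `r`, the prototile
being the right triangle with legs `1` and `2` and hypotenuse `√5`. -/
def IsScaledPrototile (r : ℝ) (T : Triangle) : Prop :=
  dist T.right T.short = r ∧ dist T.right T.long = 2 * r ∧
    dist T.short T.long = Real.sqrt 5 * r

/-- The pinwheel dissection of a `1 : 2 : √5` triangle with right angle at `C`, short leg `CA` and
long leg `CB` into five triangles, similar to it with ratio `1 / √5`. Here `D` and `E` lie on the
hypotenuse, at one fifth and three fifths of the way from `A` to `B`, `F` is the midpoint of the
long leg, and `G` is the midpoint of `CD` (`CD` is the altitude). -/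
noncomputable def dissect (T : Triangle) : Set Triangle :=
  let C := T.right
  let A := T.short
  let B := T.long
  let D := (4 * A + B) / 5
  let E := (2 * A + 3 * B) / 5
  let F := (B + C) / 2
  let G := (C + D) / 2
  {⟨D, A, C⟩, ⟨G, C, F⟩, ⟨G, D, F⟩, ⟨E, F, D⟩, ⟨E, F, B⟩}

/-- The triangles obtained from `T` by applying the pinwheel dissection `n` times. -/
noncomputable def iterDissect : ℕ → Triangle → Set Triangle
  | 0, T => {T}
  | n + 1, T => ⋃ S ∈ dissect T, iterDissect n S

end Triangle

/-- The pinwheel substitution inflates a tile by `√5` and applies the pinwheel dissection. So the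
supertiles of level `n`, up to congruence, are the patches of unit-size tiles obtained from a
prototile scaled by `(√5) ^ n` by `n` dissections. -/
def IsSupertile (n : ℕ) (P : Set Triangle) : Prop :=
  ∃ S : Triangle, S.IsScaledPrototile (Real.sqrt 5 ^ n) ∧ P = S.iterDissect n

/-- `𝒯` is a pinwheel tiling: a tiling of the plane by congruent copies of the prototile, every
finite patch of which occurs in some supertile of the pinwheel substitution. -/
structure IsPinwheelTiling (𝒯 : Set Triangle) : Prop where
  isScaledPrototile : ∀ T ∈ 𝒯, T.IsScaledPrototile 1
  covers : ∀ z : ℂ, ∃ T ∈ 𝒯, z ∈ T.region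
  disjoint_interior : ∀ T ∈ 𝒯, ∀ T' ∈ 𝒯, T ≠ T' →
    Disjoint (interior T.region) (interior T'.region)
  legal : ∀ F : Set Triangle, F.Finite → F ⊆ 𝒯 → ∃ (n : ℕ) (P : Set Triangle),
    IsSupertile n P ∧ F ⊆ P

/-- The vertices of a tiling: all corners of its tiles. -/
def vertices (𝒯 : Set Triangle) : Set ℂ := {z | ∃ T ∈ 𝒯, z ∈ T.corners}

/-- The graph of a tiling. Its vertices are the corners of the tiles, and its edges are the segments
into which these points divide the sides of the tiles: two distinct vertices are adjacent if they lie
on a common side of a tile and no vertex lies strictly between them. -/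
def tilingGraph (𝒯 : Set Triangle) : SimpleGraph (vertices 𝒯) where
  Adj x y := x ≠ y ∧ (∃ T ∈ 𝒯, ∃ s ∈ T.sides, (x : ℂ) ∈ s ∧ (y : ℂ) ∈ s) ∧
    ∀ z ∈ vertices 𝒯, z ∉ openSegment ℝ (x : ℂ) (y : ℂ)
  symm := ⟨fun x y h => ⟨h.1.symm,
    (by obtain ⟨T, hT, s, hs, hx, hy⟩ := h.2.1; exact ⟨T, hT, s, hs, hy, hx⟩),
    by rw [openSegment_symm]; exact h.2.2⟩⟩
  loopless := ⟨fun _ h => h.1 rfl⟩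

end Pinwheel

/-- The chromatic index of a graph: the least number of colours in a colouring of the edges in which
any two distinct edges with a common endpoint have different colours (`⊤` if no finite number of
colours suffices). -/
noncomputable def SimpleGraph.chromaticIndex {V : Type*} (G : SimpleGraph V) : ℕ∞ :=
  G.lineGraph.chromaticNumber

/-!
All tiles of a supertile that meet a given tile lie in one of finitely many positions relative to
it: the list `neighbours` contains the identity, and if two triangles are in one of these positions,
then so are any two of their children that touch. Hence every local question about supertiles is a
finite computation with similarities over `ℚ(i)`. For instance, the only points of a tile that can
be vertices are its corners and the midpoint `1` of its long leg, which leaves five kinds of edges.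

The edges are coloured by `ZMod 8`. Up to sign, the direction of an edge is a product of a power of
`i` and a power of `(2 - i) / √5`, and modulo `4` the colour of an edge of direction
`± i ^ a * ((2 - i) / √5) ^ b` is `2 * a + 3 * b`. So edges of different directions at a vertex get
different colours, and the remaining bit, which the dissection hands down in `child`, separates the
two edges that continue one another through a vertex. The relative position of two tiles does not
tell whether the midpoint of a long leg is a vertex; where this matters, the relative positions of
the parents of the two tiles decide it. By compactness the colouring passes from the finite patches
to the tiling. Conversely, the twice dissected prototile already has an interior vertex at which
eight edges meet.
-/

namespace Pinwheel

open scoped Pointwise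

theorem lineGraph_adj_iff_map_coe {α : Type*} {V : Set α} {G : SimpleGraph V} {e e' : G.edgeSet} :
    G.lineGraph.Adj e e' ↔ e.1.map (↑) ≠ e'.1.map ((↑) : V → α) ∧
      ∃ z : α, z ∈ e.1.map (↑) ∧ z ∈ e'.1.map (↑) := by
  rw [SimpleGraph.lineGraph_adj_iff_exists]
  refine and_congr ?_ ⟨?_, ?_⟩
  · rw [(Sym2.map.injective Subtype.val_injective).ne_iff, Ne, Subtype.ext_iff]
  · rintro ⟨v, h, h'⟩
    exact ⟨v, Sym2.mem_map.2 ⟨v, h, rfl⟩, Sym2.mem_map.2 ⟨v, h', rfl⟩⟩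
  · rintro ⟨z, h, h'⟩
    obtain ⟨v, hv, rfl⟩ := Sym2.mem_map.1 h
    obtain ⟨v', hv', hvv'⟩ := Sym2.mem_map.1 h'
    exact ⟨v, hv, Subtype.ext hvv' ▸ hv'⟩

theorem colorable_of_forall_finite_induce {V : Type*} {G : SimpleGraph V} {n : ℕ}
    (h : ∀ s : Set V, s.Finite → (G.induce s).Colorable n) : G.Colorable n := by
  refine SimpleGraph.nonempty_hom_of_forall_finite_subgraph_hom fun G' hG' => ?_
  exact (h G'.verts hG').some.comp ⟨id, fun h => G'.adj_sub h⟩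

/-! ### Labelled similarities -/

/-- `star z` if `flip` is true, and `z` otherwise. -/
def conjIf {M : Type*} [Star M] (flip : Bool) (z : M) : M :=
  bif flip then star z else z

section conjIf

variable {A : Type*} [CommRing A] [StarRing A] (f g : Bool)

@[simp]
theorem conjIf_zero : conjIf f (0 : A) = 0 := by
  cases f <;> simp [conjIf]

@[simp]
theorem conjIf_one : conjIf f (1 : A) = 1 := by
  cases f <;> simp [conjIf]

@[simp]
theorem conjIf_units_one : conjIf f (1 : Aˣ) = 1 := by
  cases f <;> simp [conjIf]

theorem conjIf_add (z w : A) : conjIf f (z + w) = conjIf f z + conjIf f w := by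
  cases f <;> simp [conjIf]

theorem conjIf_mul (z w : A) : conjIf f (z * w) = conjIf f z * conjIf f w := by
  cases f <;> simp [conjIf]

theorem conjIf_conjIf {M : Type*} [InvolutiveStar M] (z : M) :
    conjIf f (conjIf g z) = conjIf (xor f g) z := by
  cases f <;> cases g <;> simp [conjIf]

@[simp]
theorem coe_conjIf (u : Aˣ) : (↑(conjIf f u) : A) = conjIf f (u : A) := by
  cases f <;> simp [conjIf]

end conjIf

/-- `-k` if `flip` is true, and `k` otherwise. -/
def signed (flip : Bool) (k : ZMod 8) : ZMod 8 :=
  bif flip then -k else k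

theorem signed_add (f : Bool) (k l : ZMod 8) : signed f (k + l) = signed f k + signed f l := by
  cases f <;> simp [signed, add_comm]

theorem signed_signed (f g : Bool) (k : ZMod 8) : signed f (signed g k) = signed (xor f g) k := by
  cases f <;> cases g <;> simp [signed]

/-- A similarity `z ↦ offset + factor * z` or, if `flip` holds, `z ↦ offset + factor * star z`, of a
commutative ring with involution, together with a label that records how the similarity acts on the
colours of edges. The label is independent of the other fields, so the same map can carry different
labels. -/
@[ext]
structure Similarity (A : Type*) [CommRing A] [StarRing A] where
  label : ZMod 8
  flip : Bool
  offset : A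
  factor : Aˣ
deriving DecidableEq

namespace Similarity

variable {A B : Type*} [CommRing A] [StarRing A] [CommRing B] [StarRing B]

/-- The colour of the image under `M` of an edge of colour `k`. -/
def relabel (M : Similarity A) (k : ZMod 8) : ZMod 8 :=
  M.label + signed M.flip k

instance : SMul (Similarity A) A :=
  ⟨fun M z => M.offset + M.factor * conjIf M.flip z⟩

instance : Mul (Similarity A) :=
  ⟨fun M N => ⟨M.relabel N.label, xor M.flip N.flip, M • N.offset,
    M.factor * conjIf M.flip N.factor⟩⟩

instance : One (Similarity A) :=
  ⟨⟨0, false, 0, 1⟩⟩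

instance : Inv (Similarity A) :=
  ⟨fun M => ⟨signed M.flip (-M.label), M.flip,
    conjIf M.flip (-(↑M.factor⁻¹ * M.offset)), conjIf M.flip M.factor⁻¹⟩⟩

theorem smul_def (M : Similarity A) (z : A) : M • z = M.offset + M.factor * conjIf M.flip z :=
  rfl

theorem mul_def (M N : Similarity A) : M * N = ⟨M.relabel N.label, xor M.flip N.flip,
    M • N.offset, M.factor * conjIf M.flip N.factor⟩ :=
  rfl

theorem one_def : (1 : Similarity A) = ⟨0, false, 0, 1⟩ :=
  rfl

theorem inv_def (M : Similarity A) : M⁻¹ = ⟨signed M.flip (-M.label), M.flip,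
    conjIf M.flip (-(↑M.factor⁻¹ * M.offset)), conjIf M.flip M.factor⁻¹⟩ :=
  rfl

theorem relabel_mul (M N : Similarity A) (k : ZMod 8) :
    (M * N).relabel k = M.relabel (N.relabel k) := by
  simp only [relabel, mul_def, signed_add, signed_signed, add_assoc]

theorem relabel_injective (M : Similarity A) : Function.Injective M.relabel := by
  intro k l h
  cases hf : M.flip <;> simpa [relabel, signed, hf] using h

theorem mul_smul' (M N : Similarity A) (z : A) : (M * N) • z = M • N • z := by
  simp only [smul_def, mul_def, Units.val_mul, coe_conjIf, conjIf_add, conjIf_mul, conjIf_conjIf]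
  ring

instance : Group (Similarity A) :=
  Group.ofLeftAxioms
    (fun M N P => Similarity.ext (relabel_mul M N P.label) (Bool.xor_assoc _ _ _)
      (mul_smul' M N P.offset)
      (Units.ext (by simp [mul_def, conjIf_mul, conjIf_conjIf, mul_assoc])))
    (fun M => by
      ext <;> simp [mul_def, one_def, smul_def, conjIf, relabel, signed])
    (fun M => by
      obtain ⟨k, f, c, u⟩ := M
      ext <;> cases f <;> simp [inv_def, mul_def, one_def, smul_def, conjIf, relabel, signed])

instance : MulAction (Similarity A) A where
  one_smul z := by simp [smul_def, one_def, conjIf]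
  mul_smul := mul_smul'

/-- The similarity of `B` induced by a similarity of `A` along a map of rings with involution. -/
def map {R : Type*} [CommSemiring R] [Algebra R A] [Algebra R B] (φ : A →⋆ₐ[R] B) :
    Similarity A →* Similarity B where
  toFun M := ⟨M.label, M.flip, φ M.offset, Units.map φ M.factor⟩
  map_one' := by ext <;> simp [one_def]
  map_mul' M N := by
    ext <;> cases hM : M.flip <;> simp [mul_def, smul_def, conjIf, hM, relabel, map_star]

theorem map_smul_map {R : Type*} [CommSemiring R] [Algebra R A] [Algebra R B] (φ : A →⋆ₐ[R] B)
    (M : Similarity A) (z : A) : map φ M • φ z = φ (M • z) := by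
  cases hM : M.flip <;> simp [map, smul_def, conjIf, hM, map_star]

theorem relabel_map {R : Type*} [CommSemiring R] [Algebra R A] [Algebra R B] (φ : A →⋆ₐ[R] B)
    (M : Similarity A) (k : ZMod 8) : (map φ M).relabel k = M.relabel k :=
  rfl

end Similarity

/-- The field `ℚ(i)`. -/
abbrev GaussianRat : Type := QuadraticAlgebra ℚ (-1) 0

namespace GaussianRat

/-- The embedding of `ℚ(i)` into the complex numbers. -/
noncomputable def toComplex : GaussianRat →⋆ₐ[ℚ] ℂ where
  __ := QuadraticAlgebra.lift ⟨Complex.I, by simp⟩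
  map_star' z := by
    simp [QuadraticAlgebra.lift, QuadraticAlgebra.re_star, QuadraticAlgebra.im_star]

noncomputable instance : Coe GaussianRat ℂ :=
  ⟨toComplex⟩

noncomputable instance : Coe (Similarity GaussianRat) (Similarity ℂ) :=
  ⟨Similarity.map toComplex⟩

theorem toComplex_apply (z : GaussianRat) : (z : ℂ) = ⟨z.re, z.im⟩ := by
  apply Complex.ext <;> simp [toComplex, QuadraticAlgebra.lift]

theorem toComplex_injective : Function.Injective toComplex := fun z w h => by
  simpa [toComplex_apply, QuadraticAlgebra.ext_iff] using h

end GaussianRat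

instance : Fact (∀ r : ℚ, r ^ 2 ≠ -1 + 0 * r) :=
  ⟨fun r => by nlinarith [sq_nonneg r]⟩

/-! ### Relative positions of tiles -/

/-- The similarity of `ℚ(i)` with offset `(x + y i) / n` and factor `(p + q i) / n`. -/
def place (n : ℕ) [NeZero n] (x y p q : ℤ) (flip : Bool) (label : ZMod 8)
    (h : p ≠ 0 ∨ q ≠ 0 := by decide) : Similarity GaussianRat where
  offset := ⟨x / n, y / n⟩
  factor := Units.mk0 ⟨p / n, q / n⟩ fun h₀ => by
    simp [QuadraticAlgebra.ext_iff, NeZero.ne] at h₀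
    tauto
  flip := flip
  label := label

/-- The similarities that take the prototile, with right angle at `0`, short leg from `0` to `i` and
long leg from `0` to `2`, to the five triangles of its dissection, in the order `ACD`, `CFG`, `DFG`,
`DEF`, `BEF`. The factors are `± i ^ a * (2 - i) / 5`, and the labels are `2 * a + 3` modulo `4`;
their residues modulo `8` are chosen so that `ends_eq_of_label_eq` holds. -/
def child : Fin 5 → Similarity GaussianRat :=
  ![place 5 2 4 (-1) (-2) true 5, place 5 1 2 2 (-1) true 3, place 5 1 2 2 (-1) false 3,
    place 5 6 2 (-2) 1 false 3, place 5 6 2 2 (-1) true 7]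

/-- One of `r` and `r⁻¹` for each `r` in `neighbours`. The list was found by closing the identity
under passing to children that meet. -/
def halfNeighbours : List (Similarity GaussianRat) :=
  [place 1 0 0 1 0 false 0, place 1 1 0 0 (-1) false 2, place 1 1 0 0 (-1) true 2,
    place 1 2 0 0 1 true 2, place 1 0 0 1 0 true 0, place 1 2 1 (-1) 0 true 0,
    place 1 2 (-1) 1 0 false 4, place 1 2 1 (-1) 0 false 0, place 1 2 1 1 0 true 4,
    place 1 0 0 (-1) 0 true 4, place 1 4 0 (-1) 0 false 4, place 1 3 0 0 1 false 6,
    place 1 4 0 (-1) 0 true 4, place 1 3 0 0 (-1) true 2, place 1 (-1) 1 0 1 true 2,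
    place 1 1 1 0 1 false 2, place 1 1 1 (-1) 0 true 4, place 1 1 0 (-1) 0 false 0,
    place 1 1 0 1 0 true 4, place 1 0 1 0 1 false 6, place 1 0 (-2) 0 1 false 2,
    place 1 0 2 1 0 true 0, place 1 0 0 (-1) 0 false 4, place 1 2 (-2) 0 1 false 2,
    place 1 2 (-2) 0 1 true 2, place 1 0 2 (-1) 0 false 4, place 5 13 (-4) (-4) (-3) true 0,
    place 5 4 8 3 (-4) true 6, place 5 (-8) (-1) 4 3 true 4, place 5 4 (-8) 3 4 false 2,
    place 5 (-8) (-1) 4 3 false 4, place 5 14 3 (-3) 4 false 6, place 5 3 9 (-4) 3 false 4,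
    place 5 14 3 3 (-4) true 2, place 5 (-3) 9 4 3 true 0, place 5 16 (-8) (-3) 4 true 2,
    place 5 4 (-8) 3 4 true 2, place 5 14 (-3) (-3) (-4) true 2, place 5 14 (-3) 3 4 false 6,
    place 5 (-4) 8 3 4 true 2, place 5 4 8 (-3) 4 false 2, place 5 (-4) 2 (-3) 4 true 2,
    place 5 13 (-4) 4 3 false 4, place 5 18 6 (-4) (-3) true 4, place 5 18 (-6) (-4) 3 false 4,
    place 25 64 48 (-7) (-24) true 4, place 25 57 24 24 (-7) true 2, place 25 (-24) 32 7 24 true 0]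

/-- The positions, relative to a tile of a supertile, of the tiles that meet it: `neighbours` is
closed under inversion and, by `neighbours_closed`, under passing to children that meet. -/
def neighbours : List (Similarity GaussianRat) :=
  halfNeighbours ++ halfNeighbours.map (·⁻¹)

/-- The corners of the prototile. -/
def prototileCorners : List GaussianRat :=
  [0, ⟨0, 1⟩, 2]

/-- The points of the prototile that can be vertices of a tiling: its corners and the midpoint of
its long leg. -/
def nodes : List GaussianRat :=
  1 :: prototileCorners

/-- The centroid of the prototile. -/
def prototileCentroid : GaussianRat :=
  ⟨2 / 3, 1 / 3⟩

/-- Membership in the closed region of the prototile. -/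
abbrev InPrototile (z : GaussianRat) : Prop :=
  0 ≤ z.re ∧ 0 ≤ z.im ∧ z.re + 2 * z.im ≤ 2

/-- The line through one of the sides of the prototile strictly separates the prototile from its
image under `r`. -/
abbrev IsSeparated (r : Similarity GaussianRat) : Prop :=
  (∀ z ∈ prototileCorners, (r • z).im < 0) ∨ (∀ z ∈ prototileCorners, (r • z).re < 0) ∨
    ∀ z ∈ prototileCorners, 2 < (r • z).re + 2 * (r • z).im

theorem one_mem_neighbours : 1 ∈ neighbours := by
  decide +kernel

theorem neighbours_closed : ∀ r ∈ halfNeighbours, ∀ i j, IsSeparated ((child i)⁻¹ * r * child j) ∨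
    IsSeparated ((child i)⁻¹ * r * child j)⁻¹ ∨ (child i)⁻¹ * r * child j ∈ neighbours := by
  decide +kernel

theorem inPrototile_child_smul : ∀ i, ∀ q ∈ prototileCorners, InPrototile (child i • q) := by
  decide +kernel

theorem inPrototile_of_mem_nodes : ∀ q ∈ nodes, InPrototile q := by
  decide +kernel

theorem smul_corner_mem_nodes :
    ∀ r ∈ neighbours, ∀ q ∈ prototileCorners, InPrototile (r • q) → r • q ∈ nodes := by
  decide +kernel

theorem eq_one_of_centroid_mem :
    ∀ r ∈ neighbours, InPrototile (r⁻¹ • prototileCentroid) → r = 1 := by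
  decide +kernel

/-- The five positions of an edge on the sides of a tile. The long leg is a single edge `long`, or
it is divided by its midpoint into `near`, at the right angle, and `far`. -/
inductive EdgeKind
  | short | hyp | near | far | long
deriving DecidableEq

namespace EdgeKind

instance : Fintype EdgeKind :=
  ⟨{short, hyp, near, far, long}, by rintro (_ | _) <;> decide⟩

/-- The endpoints of an edge of the prototile. -/
def ends : EdgeKind → Sym2 GaussianRat
  | short => s(0, ⟨0, 1⟩)
  | hyp => s(⟨0, 1⟩, 2)
  | near => s(0, 1)
  | far => s(1, 2)
  | long => s(0, 2)

/-- The colour of an edge of the prototile. The halves of the long leg differ by `4`, since they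
meet at its midpoint. -/
def label : EdgeKind → ZMod 8
  | short => 2
  | hyp => 3
  | near => 0
  | far => 4
  | long => 4

/-- The edge is one of the halves of the long leg. -/
abbrev IsHalf (k : EdgeKind) : Prop :=
  k = near ∨ k = far

end EdgeKind

/-- The position, relative to the prototile, of a tile whose short leg prolongs the long leg of the
prototile beyond the right angle. -/
def quarterTurn : Similarity GaussianRat :=
  place 1 (-1) 0 0 (-1) false 2

/-- The position, relative to the prototile, of its image under the half turn about the right
angle. -/
def pointReflection : Similarity GaussianRat :=
  place 1 0 0 (-1) 0 false 4

/-- The position, relative to the prototile, of its mirror image in the short leg. -/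
def legReflection : Similarity GaussianRat :=
  place 1 0 0 (-1) 0 true 4

/-- A tile in position `r` relative to the prototile shows that the midpoint of the long leg of the
prototile is a vertex. For `quarterTurn` this is a consequence of `quarterTurn_parents`. -/
def DividesLongLeg (r : Similarity GaussianRat) : Prop :=
  (∃ q ∈ prototileCorners, r • q = 1) ∨ r = quarterTurn

/-- The midpoint of the long leg of a tile in position `r` relative to the prototile is a vertex if
and only if the midpoint of the long leg of the prototile is one. For the two reflections this is a
consequence of `reflection_parents`. -/
def TiesLongLegs (r : Similarity GaussianRat) : Prop :=
  r • (1 : GaussianRat) = 1 ∨ r = pointReflection ∨ r = legReflection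

instance : DecidablePred DividesLongLeg :=
  fun _ => inferInstanceAs (Decidable (_ ∨ _))

instance : DecidablePred TiesLongLegs :=
  fun _ => inferInstanceAs (Decidable (_ ∨ _))

theorem ends_eq_of_label_eq : ∀ r ∈ neighbours, ∀ k k' : EdgeKind,
    k.label = r.relabel k'.label → (∃ q ∈ nodes, q ∈ k'.ends ∧ r • q ∈ k.ends) →
      k.ends = k'.ends.map (r • ·) ∨
      k = .long ∧ DividesLongLeg r ∨ k' = .long ∧ DividesLongLeg r⁻¹ ∨
      TiesLongLegs r ∧ (k = .long ∧ k'.IsHalf ∨ k.IsHalf ∧ k' = .long) := by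
  decide +kernel

theorem quarterTurn_parents :
    ∀ i j, child i * quarterTurn * (child j)⁻¹ ∈ neighbours → i = 0 := by
  decide +kernel

theorem reflection_parents : ∀ r ∈ [pointReflection, legReflection], ∀ i j,
    child i * r * (child j)⁻¹ ∈ neighbours → i = 0 ∧ j = 0 ∨
      3 ≤ i ∧ 3 ≤ j ∧ (child i * r * (child j)⁻¹) • child j • (1 : GaussianRat) = child j • 1 := by
  decide +kernel

theorem exists_corner_eq_mid : ∀ r ∈ neighbours, ∀ i j : Fin 5, 3 ≤ i → 3 ≤ j →
    (∃ l, ∃ q ∈ prototileCorners, (r * child l) • q = child i • 1) →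
      ∃ l, ∃ q ∈ prototileCorners, (r * child l) • q = child j • 1 := by
  decide +kernel

theorem mid_child_zero : child 0 • (1 : GaussianRat) = child 1 • 0 := by
  decide +kernel

theorem mem_nodes_of_mem_ends : ∀ k : EdgeKind, ∀ q, q ∈ k.ends → q ∈ nodes := by
  rintro (_ | _) <;> simp [EdgeKind.ends, nodes, prototileCorners]

theorem mem_corners_or_of_mem_ends : ∀ k : EdgeKind, ∀ q, q ∈ k.ends →
    q ∈ prototileCorners ∨ q = 1 ∧ k.IsHalf := by
  rintro (_ | _) <;> simp [EdgeKind.ends, EdgeKind.IsHalf, prototileCorners]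

theorem one_mem_ends : ∀ k : EdgeKind, k.IsHalf → 1 ∈ k.ends := by
  decide +kernel

/-- The point `z` lies on the segment from `a` to `b`: the vectors `z - a` and `b - z` have the same
direction, or one of them vanishes. -/
abbrev IsBetween (a z b : GaussianRat) : Prop :=
  ((z - a) * star (b - z)).im = 0 ∧ 0 ≤ ((z - a) * star (b - z)).re

theorem exists_ends_eq : ∀ a ∈ prototileCorners, ∀ b ∈ prototileCorners, ∀ q ∈ nodes,
    ∀ q' ∈ nodes, q ≠ q' → IsBetween a q b → IsBetween a q' b →
      ∃ k : EdgeKind, k.ends = s(q, q') := by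
  decide +kernel

theorem eq_one_of_isBetween : ∀ k : EdgeKind, ∀ a ∈ nodes, ∀ b ∈ nodes, k.ends = s(a, b) →
    ∀ z ∈ nodes, z ≠ a → z ≠ b → IsBetween a z b → k = .long ∧ z = 1 := by
  decide +kernel

theorem not_isDiag_ends : ∀ k : EdgeKind, ¬ k.ends.IsDiag := by
  decide +kernel

/-! ### Similarities of the plane -/

open Complex (I)
open GaussianRat

namespace Similarity

/-- A similarity of the plane as a real affine map. -/
noncomputable def toAffineMap (M : Similarity ℂ) : ℂ →ᵃ[ℝ] ℂ where
  toFun z := M • z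
  linear :=
    { toFun z := M.factor * conjIf M.flip z
      map_add' z w := by rw [conjIf_add, mul_add]
      map_smul' t z := by cases h : M.flip <;> simp [conjIf, mul_left_comm] }
  map_vadd' z w := by
    simp only [smul_def, vadd_eq_add, conjIf_add, LinearMap.coe_mk, AddHom.coe_mk]
    ring

theorem smul_convexHull (M : Similarity ℂ) (s : Set ℂ) :
    M • convexHull ℝ s = convexHull ℝ (M • s) :=
  M.toAffineMap.image_convexHull s

theorem smul_segment (M : Similarity ℂ) (z w : ℂ) :
    M • segment ℝ z w = segment ℝ (M • z) (M • w) :=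
  image_segment ℝ M.toAffineMap z w

theorem smul_openSegment (M : Similarity ℂ) (z w : ℂ) :
    M • openSegment ℝ z w = openSegment ℝ (M • z) (M • w) :=
  image_openSegment ℝ M.toAffineMap z w

theorem coe_smul_coe (r : Similarity GaussianRat) (z : GaussianRat) :
    (r : Similarity ℂ) • (z : ℂ) = (r • z : GaussianRat) :=
  map_smul_map toComplex r z

theorem mul_coe_smul_coe (M : Similarity ℂ) (r : Similarity GaussianRat) (z : GaussianRat) :
    (M * r) • (z : ℂ) = M • ((r • z : GaussianRat) : ℂ) := by
  rw [mul_smul, coe_smul_coe]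

theorem coe_injective : Function.Injective ((↑) : Similarity GaussianRat → Similarity ℂ) := by
  intro r s h
  have h' := Similarity.ext_iff.1 h
  exact Similarity.ext h'.1 h'.2.1 (toComplex_injective h'.2.2.1)
    (Units.map_injective toComplex_injective h'.2.2.2)

end Similarity

namespace Triangle

noncomputable instance : MulAction (Similarity ℂ) Triangle where
  smul M T := ⟨M • T.right, M • T.short, M • T.long⟩
  one_smul T := by ext1 <;> exact one_smul _ _
  mul_smul M N T := by ext1 <;> exact mul_smul _ _ _

theorem smul_def (M : Similarity ℂ) (T : Triangle) :
    M • T = ⟨M • T.right, M • T.short, M • T.long⟩ :=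
  rfl

theorem subset_region_of_mem_sides {T : Triangle} {s : Set ℂ} (hs : s ∈ T.sides) :
    s ⊆ T.region := by
  have hcorner {z : ℂ} (hz : z ∈ T.corners) : z ∈ T.region := subset_convexHull ℝ _ hz
  rcases hs with rfl | rfl | rfl <;>
    exact (convex_convexHull ℝ _).segment_subset (hcorner (by simp [corners]))
      (hcorner (by simp [corners]))

variable (M : Similarity ℂ) (T : Triangle)

theorem corners_smul : (M • T).corners = M • T.corners := by
  simp only [Triangle.corners, smul_def, Set.smul_set_insert, Set.smul_set_singleton]

theorem region_smul : (M • T).region = M • T.region := by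
  rw [region, corners_smul, region, Similarity.smul_convexHull]

theorem sides_smul : (M • T).sides = M • T.sides := by
  simp only [sides, smul_def, Set.smul_set_insert, Set.smul_set_singleton, Similarity.smul_segment]

theorem dissect_smul : (M • T).dissect = M • T.dissect := by
  simp only [dissect, smul_def, Set.smul_set_insert, Set.smul_set_singleton, Similarity.smul_def]
  cases M.flip <;> simp [conjIf] <;> ring_nf

theorem iterDissect_smul (n : ℕ) : (M • T).iterDissect n = M • T.iterDissect n := by
  induction n generalizing T with
  | zero => simp only [iterDissect, Set.smul_set_singleton]
  | succ n ih =>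
    simp only [iterDissect, dissect_smul, Set.smul_set_iUnion₂, ← ih]
    simp only [← Set.image_smul, Set.biUnion_image]

/-- The prototile, with its right angle at the origin. -/
noncomputable def prototile : Triangle :=
  ⟨0, I, 2⟩

theorem mem_region_prototile {z : ℂ} :
    z ∈ prototile.region ↔ 0 ≤ z.re ∧ 0 ≤ z.im ∧ z.re + 2 * z.im ≤ 2 := by
  constructor
  · have hconvex : Convex ℝ {z : ℂ | 0 ≤ z.re ∧ 0 ≤ z.im ∧ z.re + 2 * z.im ≤ 2} := by
      intro z ⟨hz₁, hz₂, hz₃⟩ w ⟨hw₁, hw₂, hw₃⟩ a b ha hb hab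
      simp only [Set.mem_ofPred_eq, Complex.add_re, Complex.real_smul, Complex.re_ofReal_mul,
        Complex.add_im, Complex.im_ofReal_mul]
      refine ⟨by positivity, by positivity, ?_⟩
      nlinarith [mul_le_mul_of_nonneg_left hz₃ ha, mul_le_mul_of_nonneg_left hw₃ hb]
    refine fun hz => convexHull_min ?_ hconvex hz
    rintro _ (rfl | rfl | rfl) <;> norm_num [prototile]
  · rintro ⟨hre, him, hsum⟩
    have hz : z = ∑ i : Fin 3,
        (![1 - z.re / 2 - z.im, z.im, z.re / 2] i) • (![0, I, 2] i : ℂ) := by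
      apply Complex.ext <;> simp [Fin.sum_univ_three]
    rw [hz]
    refine (convex_convexHull ℝ _).sum_mem ?_ ?_ fun i _ => subset_convexHull ℝ _ ?_
    · intro i _
      fin_cases i <;> simp <;> linarith
    · simp [Fin.sum_univ_three]
    · fin_cases i <;> simp [prototile, Triangle.corners]

theorem coe_mem_region_prototile {z : GaussianRat} :
    (z : ℂ) ∈ prototile.region ↔ InPrototile z := by
  simp only [mem_region_prototile, toComplex_apply]
  norm_cast

end Triangle

open Triangle

theorem prototile_eq :
    prototile = ⟨(0 : GaussianRat), (⟨0, 1⟩ : GaussianRat), (2 : GaussianRat)⟩ := by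
  simp only [map_zero, map_ofNat, toComplex_apply, Rat.cast_zero, Rat.cast_one]
  rfl

theorem mem_corners_prototile {z : ℂ} :
    z ∈ prototile.corners ↔ ∃ q ∈ prototileCorners, (q : ℂ) = z := by
  simp [prototile_eq, Triangle.corners, prototileCorners, eq_comm]

theorem dissect_prototile :
    prototile.dissect = Set.range fun i => (child i : Similarity ℂ) • prototile := by
  have h : (fun i => (child i : Similarity ℂ) • prototile) = ![⟨(4 * I + 2) / 5, I, 0⟩,
      ⟨(4 * I + 2) / 5 / 2, 0, 1⟩, ⟨(4 * I + 2) / 5 / 2, (4 * I + 2) / 5, 1⟩,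
      ⟨(2 * I + 3 * 2) / 5, 1, (4 * I + 2) / 5⟩, ⟨(2 * I + 3 * 2) / 5, 1, 2⟩] := by
    funext i
    fin_cases i <;> ext1 <;> apply Complex.ext <;>
      simp [prototile, Triangle.smul_def, Similarity.smul_def, Similarity.map, child, place,
        toComplex_apply, conjIf] <;> norm_num
  rw [h]
  ext T
  simp [dissect, prototile]
  tauto

open Similarity

theorem Triangle.IsScaledPrototile.exists_smul_prototile {r : ℝ} {T : Triangle}
    (hT : T.IsScaledPrototile r) (hr : 0 < r) : ∃ M : Similarity ℂ, M • prototile = T := by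
  obtain ⟨hshort, hlong, hhyp⟩ := hT
  obtain ⟨C, A, B⟩ := T
  have hB : B - C ≠ 0 := by
    rw [← norm_pos_iff, ← dist_eq_norm, dist_comm, hlong]
    positivity
  obtain ⟨u, hu⟩ : ∃ u : ℂˣ, B = C + u * 2 := ⟨.mk0 ((B - C) / 2) (by simpa using hB), by simp⟩
  obtain ⟨w, hw⟩ : ∃ w : ℂ, A = C + u * w := ⟨(A - C) / u, by field_simp; ring⟩
  subst hu hw
  have hur : ‖(u : ℂ)‖ = r := by
    simpa [mul_comm, Complex.dist_eq] using hlong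
  have hw₁ : ‖w‖ = 1 := by
    simpa [Complex.dist_eq, hur, hr.ne'] using hshort
  have hw₂ : ‖w - 2‖ = Real.sqrt 5 := by
    simpa [Complex.dist_eq, ← mul_sub, hur, mul_comm r, hr.ne'] using hhyp
  replace hw₁ := congrArg (· ^ 2) hw₁
  replace hw₂ := congrArg (· ^ 2) hw₂
  norm_num [Complex.sq_norm, Complex.normSq_apply] at hw₁ hw₂
  have hre : w.re = 0 := by linarith
  have him : w.im * w.im = 1 := by simpa [hre] using hw₁
  rcases mul_self_eq_one_iff.1 him with him | him
  · obtain rfl : w = I := Complex.ext hre him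
    exact ⟨⟨0, false, C, u⟩, by simp [Triangle.smul_def, Similarity.smul_def, prototile, conjIf]⟩
  · obtain rfl : w = -I := Complex.ext (by simpa using hre) (by simpa using him)
    exact ⟨⟨0, true, C, u⟩, by simp [Triangle.smul_def, Similarity.smul_def, prototile, conjIf]⟩

theorem smul_eq_smul_of_smul_prototile_eq {M N : Similarity ℂ}
    (h : M • prototile = N • prototile) (z : ℂ) : M • z = N • z := by
  have barycentric (P : Similarity ℂ) :
      P • z = P • 0 + z.im * (P • I - P • 0) + z.re / 2 * (P • 2 - P • 0) := by
    cases hP : P.flip <;> apply Complex.ext <;> simp [Similarity.smul_def, conjIf, hP] <;> ring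
  obtain ⟨h₀, hI, h₂⟩ := Triangle.mk.inj h
  change M • 0 = N • 0 at h₀
  change M • I = N • I at hI
  change M • 2 = N • 2 at h₂
  rw [barycentric M, barycentric N, h₀, hI, h₂]

theorem region_subset_of_corners_subset {T T' : Triangle} (h : T.corners ⊆ T'.region) :
    T.region ⊆ T'.region :=
  convexHull_min h (convex_convexHull ℝ _)

theorem corners_smul_prototile (M : Similarity ℂ) :
    (M • prototile).corners = {z | ∃ q ∈ prototileCorners, M • (q : ℂ) = z} := by
  ext z
  simp only [corners_smul, Set.mem_smul_set, mem_corners_prototile, Set.mem_ofPred_eq]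
  aesop

theorem region_mul_child_subset (M : Similarity ℂ) (i : Fin 5) :
    ((M * child i) • prototile).region ⊆ (M • prototile).region := by
  refine region_subset_of_corners_subset ?_
  rw [corners_smul_prototile]
  rintro _ ⟨q, hq, rfl⟩
  rw [mul_coe_smul_coe, region_smul]
  exact Set.smul_mem_smul_set (coe_mem_region_prototile.2 (inPrototile_child_smul i q hq))

theorem IsSeparated.disjoint_region {r : Similarity GaussianRat} (h : IsSeparated r) :
    Disjoint prototile.region ((r : Similarity ℂ) • prototile).region := by
  have hsubset {s : Set ℂ} (hs : Convex ℝ s)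
      (h : ∀ q ∈ prototileCorners, ((r • q : GaussianRat) : ℂ) ∈ s) :
      ((r : Similarity ℂ) • prototile).region ⊆ s := by
    refine convexHull_min ?_ hs
    rw [corners_smul_prototile]
    rintro _ ⟨q, hq, rfl⟩
    rw [coe_smul_coe]
    exact h q hq
  refine Set.disjoint_left.2 fun z hz hz' => ?_
  obtain ⟨hre, him, hsum⟩ := mem_region_prototile.1 hz
  rcases h with h | h | h
  · have := hsubset (convex_halfSpace_im_lt 0) (by simpa [toComplex_apply] using h) hz'
    exact this.not_ge him
  · have := hsubset (convex_halfSpace_re_lt 0) (by simpa [toComplex_apply] using h) hz'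
    exact this.not_ge hre
  · have := hsubset (s := {z | 2 < z.re + 2 * z.im})
      (convex_halfSpace_gt ⟨by intros; simp; ring, by intros; simp; ring⟩ 2)
      (by simp only [toComplex_apply, Set.mem_ofPred_eq]; exact_mod_cast h) hz'
    exact this.not_ge hsum

theorem IsSeparated.disjoint_region_mul {r : Similarity GaussianRat} (h : IsSeparated r)
    (M : Similarity ℂ) :
    Disjoint (M • prototile).region ((M * (r : Similarity ℂ)) • prototile).region := by
  rw [mul_smul, region_smul M, region_smul M, Set.disjoint_smul_set]
  exact h.disjoint_region

theorem mul_smul_prototile_eq {M N : Similarity ℂ} (h : M • prototile = N • prototile)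
    (P : Similarity ℂ) : (M * P) • prototile = (N * P) • prototile := by
  ext1 <;> simp only [mul_smul, Triangle.smul_def] <;> exact smul_eq_smul_of_smul_prototile_eq h _

/-! ### Supertiles -/

/-- The similarities that take the prototile to the triangles of its dissection. -/
noncomputable def children : Set (Similarity ℂ) :=
  Set.range fun i => child i

/-- The similarities `S * child i₁ * ⋯ * child iₙ`: they place the triangles that `n` dissections
cut out of the triangle placed by `S`. -/
noncomputable def descendants (S : Similarity ℂ) (n : ℕ) : Set (Similarity ℂ) :=
  S • children ^ n

/-- The patch cut out of the triangle placed by `S` by `n` dissections. -/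
noncomputable def supertile (S : Similarity ℂ) (n : ℕ) : Set Triangle :=
  (S • prototile).iterDissect n

theorem iterDissect_prototile (n : ℕ) :
    prototile.iterDissect n = (fun M : Similarity ℂ => M • prototile) '' (children ^ n) := by
  induction n with
  | zero => simp [iterDissect]
  | succ n ih =>
    ext T
    simp [iterDissect, dissect_prototile, iterDissect_smul, ih, pow_succ', Set.mem_mul,
      Set.mem_smul_set, children, mul_smul]

theorem mem_supertile {S : Similarity ℂ} {n : ℕ} {T : Triangle} :
    T ∈ supertile S n ↔ ∃ M ∈ descendants S n, M • prototile = T := by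
  simp [supertile, descendants, iterDissect_smul, iterDissect_prototile, Set.mem_smul_set, mul_smul]

theorem smul_prototile_mem_supertile {S M : Similarity ℂ} {n : ℕ} (h : M ∈ descendants S n) :
    M • prototile ∈ supertile S n :=
  mem_supertile.2 ⟨M, h, rfl⟩

theorem mem_descendants_zero {S M : Similarity ℂ} : M ∈ descendants S 0 ↔ M = S := by
  simp [descendants, Set.mem_smul_set, eq_comm]

theorem mem_descendants_succ {S M : Similarity ℂ} {n : ℕ} :
    M ∈ descendants S (n + 1) ↔ ∃ N ∈ descendants S n, ∃ i, N * child i = M := by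
  simp [descendants, Set.mem_smul_set, children, pow_succ, Set.mem_mul, mul_assoc]

theorem supertile_subset (S : Similarity ℂ) (n : ℕ) :
    supertile S n ⊆ supertile (S * (child 0 : Similarity ℂ)⁻¹) (n + 1) := by
  intro T hT
  obtain ⟨_, ⟨c, hc, rfl⟩, rfl⟩ := mem_supertile.1 hT
  refine smul_prototile_mem_supertile ?_
  rw [descendants, pow_succ']
  refine ⟨child 0 * c, Set.mul_mem_mul ⟨0, rfl⟩ hc, ?_⟩
  simp [mul_assoc]

theorem inv_mem_neighbours {r : Similarity GaussianRat} (hr : r ∈ neighbours) :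
    r⁻¹ ∈ neighbours := by
  simp only [neighbours, List.mem_append, List.mem_map] at hr ⊢
  rcases hr with hr | ⟨s, hs, rfl⟩
  · exact .inr ⟨r, hr, rfl⟩
  · exact .inl (by rwa [inv_inv])

theorem child_mem_neighbours {r : Similarity GaussianRat} (hr : r ∈ neighbours) (i j : Fin 5) :
    IsSeparated ((child i)⁻¹ * r * child j) ∨ IsSeparated ((child i)⁻¹ * r * child j)⁻¹ ∨
      (child i)⁻¹ * r * child j ∈ neighbours := by
  rcases List.mem_append.1 hr with hr | hr
  · exact neighbours_closed r hr i j
  · obtain ⟨s, hs, rfl⟩ := List.mem_map.1 hr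
    have hinv : ((child j)⁻¹ * s * child i)⁻¹ = (child i)⁻¹ * s⁻¹ * child j := by group
    rw [← hinv, inv_inv]
    rcases neighbours_closed s hs j i with h | h | h
    · exact .inr (.inl h)
    · exact .inl h
    · exact .inr (.inr (inv_mem_neighbours h))

theorem exists_neighbour {S M N : Similarity ℂ} {n : ℕ} (hM : M ∈ descendants S n)
    (hN : N ∈ descendants S n)
    (hMN : ((M • prototile).region ∩ (N • prototile).region).Nonempty) :
    ∃ r ∈ neighbours, N = M * (r : Similarity ℂ) := by
  induction n generalizing M N with
  | zero =>
    obtain rfl := mem_descendants_zero.1 hM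
    obtain rfl := mem_descendants_zero.1 hN
    exact ⟨1, one_mem_neighbours, by simp⟩
  | succ n ih =>
    obtain ⟨P, hP, i, rfl⟩ := mem_descendants_succ.1 hM
    obtain ⟨P', hP', j, rfl⟩ := mem_descendants_succ.1 hN
    obtain ⟨r, hr, rfl⟩ := ih hP hP'
      (hMN.mono (Set.inter_subset_inter (region_mul_child_subset P i)
        (region_mul_child_subset P' j)))
    set s : Similarity GaussianRat := (child i)⁻¹ * r * child j with hs
    have hN' : P * (r : Similarity ℂ) * child j = P * child i * (s : Similarity ℂ) := by
      simp [hs, mul_assoc]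
    rw [hN'] at hMN ⊢
    refine ⟨s, (child_mem_neighbours hr i j).resolve_left ?_ |>.resolve_left ?_, rfl⟩
    · exact fun h => Set.not_disjoint_iff_nonempty_inter.2 hMN (h.disjoint_region_mul _)
    · intro h
      have := h.disjoint_region_mul (P * child i * (s : Similarity ℂ))
      rw [map_inv, mul_inv_cancel_right] at this
      exact Set.not_disjoint_iff_nonempty_inter.2 hMN this.symm

theorem eq_of_centroid_mem_region {S M N : Similarity ℂ} {n : ℕ} (hM : M ∈ descendants S n)
    (hN : N ∈ descendants S n) (h : M • (prototileCentroid : ℂ) ∈ (N • prototile).region) :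
    M = N := by
  have hcentroid : (prototileCentroid : ℂ) ∈ prototile.region :=
    coe_mem_region_prototile.2 (by norm_num [InPrototile, prototileCentroid])
  obtain ⟨r, hr, rfl⟩ := exists_neighbour hM hN
    ⟨_, region_smul M _ ▸ Set.smul_mem_smul_set hcentroid, h⟩
  rw [region_smul, mul_smul, Set.smul_mem_smul_set_iff, Set.mem_smul_set_iff_inv_smul_mem,
    ← map_inv, coe_smul_coe, coe_mem_region_prototile] at h
  rw [eq_one_of_centroid_mem r hr h, map_one, mul_one]

/-- The centroid of a triangle. -/
noncomputable def Triangle.centroid (T : Triangle) : ℂ :=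
  (T.right + T.short + T.long) / 3

theorem centroid_smul_prototile (M : Similarity ℂ) :
    (M • prototile).centroid = M • (prototileCentroid : ℂ) := by
  cases hM : M.flip <;> simp [Triangle.centroid, Triangle.smul_def, prototile,
    Similarity.smul_def, conjIf, hM, prototileCentroid, toComplex_apply, Complex.ext_iff] <;>
    constructor <;> ring

namespace IsPinwheelTiling

variable {𝒯 : Set Triangle}

theorem exists_smul_prototile (h𝒯 : IsPinwheelTiling 𝒯) {T : Triangle} (hT : T ∈ 𝒯) :
    ∃ M : Similarity ℂ, M • prototile = T :=
  (h𝒯.isScaledPrototile T hT).exists_smul_prototile one_pos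

theorem exists_subset_supertile (h𝒯 : IsPinwheelTiling 𝒯) {F : Set Triangle} (hF : F.Finite)
    (hF𝒯 : F ⊆ 𝒯) : ∃ S n, F ⊆ supertile S (n + 2) := by
  obtain ⟨n, _, ⟨T, hT, rfl⟩, hFT⟩ := h𝒯.legal F hF hF𝒯
  obtain ⟨S, rfl⟩ := hT.exists_smul_prototile (by positivity)
  exact ⟨_, n, hFT.trans ((supertile_subset S n).trans (supertile_subset _ _))⟩

theorem exists_subset_supertile_inter_subset (h𝒯 : IsPinwheelTiling 𝒯) {F Y : Set Triangle}
    (hF : F.Finite) (hF𝒯 : F ⊆ 𝒯) (hY : Y.Finite) :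
    ∃ S n, F ⊆ supertile S (n + 2) ∧ supertile S (n + 2) ∩ Y ⊆ 𝒯 := by
  choose cover hcover𝒯 hcover using fun T : Triangle => h𝒯.covers T.centroid
  obtain ⟨S, n, hFS⟩ := h𝒯.exists_subset_supertile (hF.union (hY.image cover))
    (Set.union_subset hF𝒯 (Set.image_subset_iff.2 fun T _ => hcover𝒯 T))
  refine ⟨S, n, Set.subset_union_left.trans hFS, fun T hT => ?_⟩
  obtain ⟨M, hM, rfl⟩ := mem_supertile.1 hT.1
  obtain ⟨N, hN, hNM⟩ := mem_supertile.1 (hFS (.inr ⟨_, hT.2, rfl⟩))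
  have hMN : M = N := eq_of_centroid_mem_region hM hN (by
    rw [hNM, ← centroid_smul_prototile]
    exact hcover _)
  rw [hMN, hNM]
  exact hcover𝒯 _

theorem exists_supertile_mem_vertices_iff (h𝒯 : IsPinwheelTiling 𝒯) {F : Set Triangle}
    (hF : F.Finite) (hF𝒯 : F ⊆ 𝒯) {Z : Set ℂ} (hZ : Z.Finite) :
    ∃ S n, F ⊆ supertile S (n + 2) ∧
      ∀ z ∈ Z, z ∈ vertices 𝒯 ↔ z ∈ vertices (supertile S (n + 2)) := by
  have hM (z : ℂ) : ∃ M : Similarity ℂ, M • prototile ∈ 𝒯 ∧ z ∈ (M • prototile).region := by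
    obtain ⟨T, hT, hz⟩ := h𝒯.covers z
    obtain ⟨M, rfl⟩ := h𝒯.exists_smul_prototile hT
    exact ⟨M, hT, hz⟩
  choose M hM𝒯 hMz using hM
  have hW (z : ℂ) : ∃ W ∈ 𝒯, z ∈ vertices 𝒯 → z ∈ W.corners := by
    by_cases hz : z ∈ vertices 𝒯
    · exact hz.imp fun W hW => ⟨hW.1, fun _ => hW.2⟩
    · exact ⟨_, hM𝒯 0, fun h => absurd h hz⟩
  choose W hW𝒯 hW using hW
  obtain ⟨S, n, hS, hS𝒯⟩ := h𝒯.exists_subset_supertile_inter_subset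
    (F := F ∪ ((fun z => M z • prototile) '' Z ∪ W '' Z))
    (Y := ⋃ z ∈ Z, (fun r : Similarity GaussianRat => (M z * (r : Similarity ℂ)) • prototile) ''
      {r | r ∈ neighbours})
    (hF.union ((hZ.image _).union (hZ.image _)))
    (by simpa [Set.subset_def, or_imp, forall_and, hM𝒯, hW𝒯] using hF𝒯)
    (hZ.biUnion fun z _ => neighbours.finite_toSet.image _)
  simp only [Set.union_subset_iff, Set.image_subset_iff] at hS
  obtain ⟨hFS, hMS, hWS⟩ := hS
  refine ⟨S, n, hFS, fun z hz => ⟨fun h => ⟨W z, hWS hz, hW z h⟩, ?_⟩⟩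
  rintro ⟨_, hT, hzT⟩
  obtain ⟨N, hN, rfl⟩ := mem_supertile.1 hT
  obtain ⟨M', hM', hMM'⟩ := mem_supertile.1 (hMS hz)
  obtain ⟨r, hr, rfl⟩ := exists_neighbour hM' hN ⟨z, hMM' ▸ hMz z, subset_convexHull ℝ _ hzT⟩
  exact ⟨_, hS𝒯 ⟨hT, Set.mem_biUnion hz ⟨r, hr, mul_smul_prototile_eq hMM'.symm _⟩⟩, hzT⟩

theorem exists_node_smul_eq (h𝒯 : IsPinwheelTiling 𝒯) {M : Similarity ℂ} {z : ℂ}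
    (hM : M • prototile ∈ 𝒯) (hz : z ∈ vertices 𝒯) (hzM : z ∈ (M • prototile).region) :
    ∃ q ∈ nodes, M • (q : ℂ) = z := by
  obtain ⟨T, hT, hzT⟩ := hz
  obtain ⟨S, n, hS⟩ := h𝒯.exists_subset_supertile (F := {M • prototile, T}) (by simp)
    (Set.pair_subset hM hT)
  obtain ⟨M', hM', hMM'⟩ := mem_supertile.1 (hS (.inl rfl))
  obtain ⟨N, hN, rfl⟩ := mem_supertile.1 (hS (.inr rfl))
  obtain ⟨r, hr, rfl⟩ := exists_neighbour hM' hN ⟨z, hMM' ▸ hzM, subset_convexHull ℝ _ hzT⟩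
  rw [corners_smul_prototile] at hzT
  obtain ⟨q, hq, rfl⟩ := hzT
  rw [← hMM', mul_coe_smul_coe, region_smul, Set.smul_mem_smul_set_iff,
    coe_mem_region_prototile] at hzM
  refine ⟨r • q, smul_corner_mem_nodes r hr q hq hzM, ?_⟩
  rw [mul_coe_smul_coe, smul_eq_smul_of_smul_prototile_eq hMM']

end IsPinwheelTiling

theorem node_mem_region (M : Similarity ℂ) {q : GaussianRat} (hq : q ∈ nodes) :
    M • (q : ℂ) ∈ (M • prototile).region := by
  rw [region_smul]
  exact Set.smul_mem_smul_set (coe_mem_region_prototile.2 (inPrototile_of_mem_nodes q hq))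

theorem mem_vertices_supertile {S : Similarity ℂ} {n : ℕ} {z : ℂ} :
    z ∈ vertices (supertile S n) ↔
      ∃ M ∈ descendants S n, ∃ q ∈ prototileCorners, M • (q : ℂ) = z := by
  constructor
  · rintro ⟨T, hT, hz⟩
    obtain ⟨M, hM, rfl⟩ := mem_supertile.1 hT
    rw [corners_smul_prototile] at hz
    exact ⟨M, hM, hz⟩
  · rintro ⟨M, hM, hz⟩
    exact ⟨_, smul_prototile_mem_supertile hM, by rwa [corners_smul_prototile]⟩

/-! ### Edges -/

/-- The edge of kind `k` on the sides of the tile placed by `M`. -/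
noncomputable def edge (M : Similarity ℂ) (k : EdgeKind) : Sym2 ℂ :=
  k.ends.map fun q : GaussianRat => M • (q : ℂ)

theorem edge_mul_coe (M : Similarity ℂ) (r : Similarity GaussianRat) (k : EdgeKind) :
    edge (M * (r : Similarity ℂ)) k =
      (k.ends.map (r • ·)).map fun q : GaussianRat => M • (q : ℂ) := by
  simp only [edge, Sym2.map_map, Function.comp_def, mul_coe_smul_coe]

/-- If `V` is the set of vertices, the tile placed by `M` has an edge of kind `k`. -/
def EdgeKind.Occurs (V : Set ℂ) (M : Similarity ℂ) (k : EdgeKind) : Prop :=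
  (k = long → M • (1 : ℂ) ∉ V) ∧ (k.IsHalf → M • (1 : ℂ) ∈ V)

theorem EdgeKind.occurs_congr {V V' : Set ℂ} {M M' : Similarity ℂ} {k : EdgeKind}
    (h : M • (1 : ℂ) ∈ V ↔ M' • (1 : ℂ) ∈ V') : k.Occurs V M ↔ k.Occurs V' M' := by
  simp only [Occurs, h]

theorem mul_coe_smul_one (M : Similarity ℂ) (r : Similarity GaussianRat) :
    (M * (r : Similarity ℂ)) • (1 : ℂ) = M • ((r • (1 : GaussianRat) : GaussianRat) : ℂ) := by
  rw [← mul_coe_smul_coe, map_one]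

section Supertile

variable {S M : Similarity ℂ} {n : ℕ} {r : Similarity GaussianRat}

theorem exists_parents (hM : M ∈ descendants S (n + 1))
    (hMr : M * (r : Similarity ℂ) ∈ descendants S (n + 1))
    (hmeet : ((M • prototile).region ∩ ((M * (r : Similarity ℂ)) • prototile).region).Nonempty) :
    ∃ P ∈ descendants S n, ∃ i j, P * (child i : Similarity ℂ) = M ∧
      child i * r * (child j)⁻¹ ∈ neighbours ∧
      P * ((child i * r * (child j)⁻¹ : Similarity GaussianRat) : Similarity ℂ) ∈
        descendants S n := by
  obtain ⟨P, hP, i, rfl⟩ := mem_descendants_succ.1 hM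
  obtain ⟨P', hP', j, hj⟩ := mem_descendants_succ.1 hMr
  rw [← hj] at hmeet
  obtain ⟨s, hs, rfl⟩ := exists_neighbour hP hP' (hmeet.mono
    (Set.inter_subset_inter (region_mul_child_subset P i) (region_mul_child_subset P' j)))
  have hsr : s = child i * r * (child j)⁻¹ := by
    rw [eq_mul_inv_iff_mul_eq]
    apply coe_injective
    simpa [mul_assoc] using hj
  exact ⟨P, hP, i, j, rfl, hsr ▸ hs, hsr ▸ hP'⟩

theorem smul_child_zero_mid_mem_vertices (hM : M ∈ descendants S n) :
    (M * child 0) • (1 : ℂ) ∈ vertices (supertile S (n + 1)) := by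
  rw [mul_coe_smul_one, mid_child_zero, ← mul_coe_smul_coe]
  exact mem_vertices_supertile.2
    ⟨_, mem_descendants_succ.2 ⟨M, hM, 1, rfl⟩, 0, by simp [prototileCorners], rfl⟩

theorem smul_child_mid_mem_vertices (hM : M ∈ descendants S n) {i j : Fin 5} (hi : 3 ≤ i)
    (hj : 3 ≤ j) (h : (M * child i) • (1 : ℂ) ∈ vertices (supertile S (n + 1))) :
    (M * child j) • (1 : ℂ) ∈ vertices (supertile S (n + 1)) := by
  obtain ⟨N, hN, q, hq, hqM⟩ := mem_vertices_supertile.1 h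
  obtain ⟨P, hP, l, rfl⟩ := mem_descendants_succ.1 hN
  have hmid : (M * child i) • (1 : ℂ) ∈ ((M * child i) • prototile).region := by
    simpa using node_mem_region (M * child i) (q := 1) (by simp [nodes])
  obtain ⟨r, hr, rfl⟩ := exists_neighbour hM hP ⟨_, region_mul_child_subset M i hmid,
    region_mul_child_subset P l (hqM ▸ node_mem_region (P * child l) (List.mem_cons_of_mem _ hq))⟩
  have hex := exists_corner_eq_mid r hr i j hi hj ⟨l, q, hq, by
    apply toComplex_injective
    apply smul_left_cancel M
    rw [← mul_coe_smul_coe, map_mul, ← mul_assoc, hqM, mul_coe_smul_one]⟩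
  obtain ⟨l', q', hq', h'⟩ := hex
  refine mem_vertices_supertile.2 ⟨_, mem_descendants_succ.2 ⟨_, hP, l', rfl⟩, q', hq', ?_⟩
  rw [mul_coe_smul_one, ← h', ← mul_coe_smul_coe, map_mul, mul_assoc]

theorem DividesLongLeg.mid_mem_vertices (h : DividesLongLeg r) (hM : M ∈ descendants S (n + 1))
    (hMr : M * (r : Similarity ℂ) ∈ descendants S (n + 1))
    (hmeet : ((M • prototile).region ∩ ((M * (r : Similarity ℂ)) • prototile).region).Nonempty) :
    M • (1 : ℂ) ∈ vertices (supertile S (n + 1)) := by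
  rcases h with ⟨q, hq, hqr⟩ | rfl
  · exact mem_vertices_supertile.2 ⟨_, hMr, q, hq, by rw [mul_coe_smul_coe, hqr, map_one]⟩
  · obtain ⟨P, hP, i, j, rfl, hij, -⟩ := exists_parents hM hMr hmeet
    obtain rfl := quarterTurn_parents i j hij
    exact smul_child_zero_mid_mem_vertices hP

theorem TiesLongLegs.mid_mem_vertices_iff (h : TiesLongLegs r) (hM : M ∈ descendants S (n + 1))
    (hMr : M * (r : Similarity ℂ) ∈ descendants S (n + 1))
    (hmeet : ((M • prototile).region ∩ ((M * (r : Similarity ℂ)) • prototile).region).Nonempty) :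
    M • (1 : ℂ) ∈ vertices (supertile S (n + 1)) ↔
      (M * (r : Similarity ℂ)) • (1 : ℂ) ∈ vertices (supertile S (n + 1)) := by
  rcases h with hr | hr
  · rw [mul_coe_smul_one, hr, map_one]
  obtain ⟨P, hP, i, j, rfl, hij, hP'⟩ := exists_parents hM hMr hmeet
  rcases reflection_parents r (by simpa using hr) i j hij with ⟨rfl, rfl⟩ | ⟨hi, hj, hmid⟩
  · have h := smul_child_zero_mid_mem_vertices hP'
    simp only [map_mul, map_inv, mul_assoc, inv_mul_cancel, mul_one] at h ⊢
    exact iff_of_true (smul_child_zero_mid_mem_vertices hP) h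
  · have : (P * child i * (r : Similarity ℂ)) • (1 : ℂ) = (P * child j) • (1 : ℂ) := by
      rw [mul_coe_smul_one P (child j), ← hmid, mul_assoc, ← map_mul, mul_coe_smul_one, ← mul_smul,
        inv_mul_cancel_right]
    rw [this]
    exact ⟨smul_child_mid_mem_vertices hP hi hj, smul_child_mid_mem_vertices hP hj hi⟩

theorem edge_eq_of_label_eq {N : Similarity ℂ} {k l : EdgeKind}
    (hM : M ∈ descendants S (n + 1)) (hN : N ∈ descendants S (n + 1))
    (hk : k.Occurs (vertices (supertile S (n + 1))) M)
    (hl : l.Occurs (vertices (supertile S (n + 1))) N)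
    (hlabel : M.relabel k.label = N.relabel l.label) {z : ℂ} (hzM : z ∈ edge M k)
    (hzN : z ∈ edge N l) : edge M k = edge N l := by
  obtain ⟨q, hq, rfl⟩ := Sym2.mem_map.1 hzM
  obtain ⟨q', hq', hqq'⟩ := Sym2.mem_map.1 hzN
  have hmeet : ((M • prototile).region ∩ (N • prototile).region).Nonempty :=
    ⟨_, node_mem_region M (mem_nodes_of_mem_ends k q hq),
      hqq' ▸ node_mem_region N (mem_nodes_of_mem_ends l q' hq')⟩
  obtain ⟨r, hr, rfl⟩ := exists_neighbour hM hN hmeet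
  have hrq' : r • q' = q := by
    rw [mul_coe_smul_coe] at hqq'
    exact toComplex_injective (smul_left_cancel M hqq')
  rw [relabel_mul, relabel_map] at hlabel
  rcases ends_eq_of_label_eq r hr k l (M.relabel_injective hlabel)
      ⟨q', mem_nodes_of_mem_ends l q' hq', hq', hrq' ▸ hq⟩ with
    h | ⟨rfl, h⟩ | ⟨rfl, h⟩ | ⟨h, ⟨rfl, hl'⟩ | ⟨hk', rfl⟩⟩
  · rw [edge_mul_coe, ← h, edge]
  · exact absurd (h.mid_mem_vertices hM hN hmeet) (hk.1 rfl)
  · refine absurd (h.mid_mem_vertices hN ?_ ?_) (hl.1 rfl) <;>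
      rw [map_inv, mul_inv_cancel_right]
    exacts [hM, Set.inter_comm _ _ ▸ hmeet]
  · exact absurd ((h.mid_mem_vertices_iff hM hN hmeet).2 (hl.2 hl')) (hk.1 rfl)
  · exact absurd ((h.mid_mem_vertices_iff hM hN hmeet).1 (hk.2 hk')) (hl.1 rfl)

end Supertile

theorem isBetween_of_mem_segment {a z b : GaussianRat} (h : (z : ℂ) ∈ segment ℝ (a : ℂ) b) :
    IsBetween a z b := by
  obtain ⟨s, t, hs, ht, hst, h⟩ := h
  obtain rfl : s = 1 - t := by linarith
  have h₁ : ((z - a : GaussianRat) : ℂ) = t * (b - a : GaussianRat) := by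
    simp only [map_sub, ← h, Complex.real_smul, Complex.ofReal_sub, Complex.ofReal_one]
    ring
  have h₂ : ((b - z : GaussianRat) : ℂ) = (1 - t : ℝ) * (b - a : GaussianRat) := by
    simp only [map_sub, ← h, Complex.real_smul, Complex.ofReal_sub, Complex.ofReal_one]
    ring
  have h₃ : (((z - a) * star (b - z) : GaussianRat) : ℂ) =
      ((t * (1 - t) * Complex.normSq (b - a : GaussianRat) : ℝ) : ℂ) := by
    rw [map_mul, map_star, h₁, h₂]
    simp only [Complex.ofReal_mul, ← Complex.mul_conj, star_mul', RCLike.star_def,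
      Complex.conj_ofReal]
    ring
  rw [toComplex_apply] at h₃
  have him := congrArg Complex.im h₃
  have hre := congrArg Complex.re h₃
  simp only [Complex.ofReal_re, Complex.ofReal_im, Rat.cast_eq_zero] at him hre
  refine ⟨him, (Rat.cast_nonneg (K := ℝ)).1 ?_⟩
  rw [hre]
  have := Complex.normSq_nonneg (b - a : GaussianRat)
  positivity

theorem exists_segment_eq {s : Set ℂ} (hs : s ∈ prototile.sides) :
    ∃ a ∈ prototileCorners, ∃ b ∈ prototileCorners, s = segment ℝ (a : ℂ) b := by
  rw [prototile_eq] at hs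
  rcases hs with rfl | rfl | rfl
  · exact ⟨_, by decide, _, by decide, rfl⟩
  · exact ⟨_, by decide, _, by decide, rfl⟩
  · exact ⟨_, by decide, _, by decide, rfl⟩

theorem one_mem_openSegment :
    ((1 : GaussianRat) : ℂ) ∈ openSegment ℝ ((0 : GaussianRat) : ℂ) (2 : GaussianRat) :=
  ⟨1 / 2, 1 / 2, by norm_num, by norm_num, by norm_num, by
    simp only [map_zero, map_one, map_ofNat, smul_zero, zero_add]; norm_num⟩

theorem exists_side (k : EdgeKind) :
    ∃ s ∈ prototile.sides, ∀ q ∈ k.ends, (q : ℂ) ∈ s := by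
  have h₁ := openSegment_subset_segment ℝ _ _ one_mem_openSegment
  rw [prototile_eq]
  cases k
  · exact ⟨_, .inl rfl, by simp [EdgeKind.ends, left_mem_segment, right_mem_segment]⟩
  · exact ⟨_, .inr (.inr rfl), by simp [EdgeKind.ends, left_mem_segment, right_mem_segment]⟩
  all_goals
    refine ⟨_, .inr (.inl rfl), ?_⟩
    simp only [EdgeKind.ends, Sym2.mem_iff]
    rintro q (rfl | rfl)
    all_goals first | exact left_mem_segment .. | exact right_mem_segment .. | exact h₁

namespace IsPinwheelTiling

variable {𝒯 : Set Triangle}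

theorem exists_edge_eq (h𝒯 : IsPinwheelTiling 𝒯) {e : Sym2 (vertices 𝒯)}
    (he : e ∈ (tilingGraph 𝒯).edgeSet) :
    ∃ M : Similarity ℂ, ∃ k : EdgeKind, M • prototile ∈ 𝒯 ∧ k.Occurs (vertices 𝒯) M ∧
      e.map (↑) = edge M k := by
  induction e with | h x y
  obtain ⟨x, hx⟩ := x
  obtain ⟨y, hy⟩ := y
  obtain ⟨hxy, ⟨T, hT, s, hs, hxs, hys⟩, hempty⟩ := he
  obtain ⟨M, rfl⟩ := h𝒯.exists_smul_prototile hT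
  rw [sides_smul] at hs
  obtain ⟨s, hs, rfl⟩ := hs
  have := region_smul M prototile ▸ Set.smul_set_mono (a := M) (subset_region_of_mem_sides hs)
  obtain ⟨q, hq, rfl⟩ := h𝒯.exists_node_smul_eq hT hx (this hxs)
  obtain ⟨q', hq', rfl⟩ := h𝒯.exists_node_smul_eq hT hy (this hys)
  obtain ⟨a, ha, b, hb, rfl⟩ := exists_segment_eq hs
  obtain ⟨k, hk⟩ := exists_ends_eq a ha b hb q hq q' hq' (by rintro rfl; exact hxy rfl)
    (isBetween_of_mem_segment (Set.smul_mem_smul_set_iff.1 hxs))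
    (isBetween_of_mem_segment (Set.smul_mem_smul_set_iff.1 hys))
  refine ⟨M, k, hT, ⟨?_, ?_⟩, by rw [edge, hk]; rfl⟩
  · rintro rfl hmid
    apply hempty _ hmid
    have hmid := Set.smul_mem_smul_set (a := M) one_mem_openSegment
    rw [smul_openSegment, map_one] at hmid
    rcases Sym2.eq_iff.1 hk with ⟨rfl, rfl⟩ | ⟨rfl, rfl⟩
    · exact hmid
    · rwa [openSegment_symm]
  · intro hhalf
    have h₁ : 1 ∈ s(q, q') := hk ▸ one_mem_ends k hhalf
    rw [← map_one toComplex]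
    rcases Sym2.mem_iff.1 h₁ with rfl | rfl
    exacts [hx, hy]

theorem exists_mem_edgeSet (h𝒯 : IsPinwheelTiling 𝒯) {M : Similarity ℂ} {k : EdgeKind}
    (hM : M • prototile ∈ 𝒯) (hk : k.Occurs (vertices 𝒯) M) :
    ∃ e ∈ (tilingGraph 𝒯).edgeSet, e.map (↑) = edge M k := by
  obtain ⟨a, b, hab⟩ : ∃ a b, k.ends = s(a, b) := Sym2.exists.1 ⟨_, rfl⟩
  have ha : a ∈ k.ends := hab ▸ Sym2.mem_mk_left a b
  have hb : b ∈ k.ends := hab ▸ Sym2.mem_mk_right a b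
  have hvertex (q) (hq : q ∈ k.ends) : M • (q : ℂ) ∈ vertices 𝒯 := by
    rcases mem_corners_or_of_mem_ends k q hq with hq | ⟨rfl, hhalf⟩
    · exact ⟨_, hM, by rw [corners_smul_prototile]; exact ⟨q, hq, rfl⟩⟩
    · rw [map_one]
      exact hk.2 hhalf
  have hne : (a : ℂ) ≠ b := fun h => not_isDiag_ends k (hab ▸ toComplex_injective h)
  obtain ⟨s, hs, hks⟩ := exists_side k
  refine ⟨s(⟨_, hvertex a ha⟩, ⟨_, hvertex b hb⟩), ⟨?_, ⟨_, hM, M • s, ?_, ?_, ?_⟩, ?_⟩, ?_⟩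
  · rwa [Ne, Subtype.mk.injEq, smul_left_cancel_iff]
  · rw [sides_smul]
    exact Set.smul_mem_smul_set hs
  · exact Set.smul_mem_smul_set (hks a ha)
  · exact Set.smul_mem_smul_set (hks b hb)
  · intro z hz hzab
    have hzM := (convex_convexHull ℝ _).openSegment_subset
      (node_mem_region M (mem_nodes_of_mem_ends k a ha))
      (node_mem_region M (mem_nodes_of_mem_ends k b hb)) hzab
    obtain ⟨q, hq, rfl⟩ := h𝒯.exists_node_smul_eq hM hz hzM
    rw [← smul_openSegment, Set.smul_mem_smul_set_iff] at hzab
    obtain ⟨rfl, rfl⟩ := eq_one_of_isBetween k a (mem_nodes_of_mem_ends k a ha) b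
      (mem_nodes_of_mem_ends k b hb) hab q hq
      (by rintro rfl; exact hne (left_mem_openSegment_iff.1 hzab))
      (by rintro rfl; exact hne (right_mem_openSegment_iff.1 hzab))
      (isBetween_of_mem_segment (openSegment_subset_segment ℝ _ _ hzab))
    rw [map_one] at hz
    exact hk.1 rfl hz
  · rw [edge, hab]
    rfl

end IsPinwheelTiling

/-! ### The chromatic index -/

theorem IsPinwheelTiling.colorable_lineGraph {𝒯 : Set Triangle} (h𝒯 : IsPinwheelTiling 𝒯) :
    (tilingGraph 𝒯).lineGraph.Colorable 8 := by
  refine colorable_of_forall_finite_induce fun E hE => ?_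
  choose M k hM𝒯 hk hedge using fun e : (tilingGraph 𝒯).edgeSet => h𝒯.exists_edge_eq e.2
  obtain ⟨S, n, hS, hvertices⟩ := h𝒯.exists_supertile_mem_vertices_iff
    (hE.image fun e => M e • prototile) (Set.image_subset_iff.2 fun e _ => hM𝒯 e)
    (hE.image fun e => M e • (1 : ℂ))
  choose N hN hNM using fun e : E => mem_supertile.1 (hS (Set.mem_image_of_mem _ e.2))
  have hNedge (e : E) : e.1.1.map (↑) = edge (N e) (k e) := by
    simp only [hedge e, edge, smul_eq_smul_of_smul_prototile_eq (hNM e)]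
  have hNk (e : E) : (k e).Occurs (vertices (supertile S (n + 2))) (N e) := by
    refine (EdgeKind.occurs_congr ?_).1 (hk e)
    rw [smul_eq_smul_of_smul_prototile_eq (hNM e)]
    exact hvertices _ (Set.mem_image_of_mem _ e.2)
  let color (e : E) : ZMod 8 := (N e).relabel (k e).label
  refine SimpleGraph.Coloring.colorable (α := ZMod 8) ⟨color, fun {e e'} hadj hcolor => ?_⟩
  obtain ⟨hne, z, hz, hz'⟩ := lineGraph_adj_iff_map_coe.1 (SimpleGraph.induce_adj.1 hadj)
  rw [hNedge] at hne hz
  rw [hNedge] at hne hz'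
  exact hne (edge_eq_of_label_eq (hN e) (hN e') (hNk e) (hNk e') hcolor hz hz')

theorem IsPinwheelTiling.exists_mul_child_mul_child_mem {𝒯 : Set Triangle}
    (h𝒯 : IsPinwheelTiling 𝒯) :
    ∃ X : Similarity ℂ, ∀ i j, (X * child i * child j) • prototile ∈ 𝒯 := by
  obtain ⟨T, hT, -⟩ := h𝒯.covers 0
  obtain ⟨M, rfl⟩ := h𝒯.exists_smul_prototile hT
  obtain ⟨S, n, hMS, hS𝒯⟩ := h𝒯.exists_subset_supertile_inter_subset (F := {M • prototile})
    (Y := Set.range fun p : Fin 5 × Fin 5 × Fin 5 × Fin 5 =>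
      (M * ((child p.1 * child p.2.1)⁻¹ * child p.2.2.1 * child p.2.2.2 : Similarity GaussianRat)) •
        prototile)
    (Set.finite_singleton _) (Set.singleton_subset_iff.2 hT) (Set.finite_range _)
  obtain ⟨M', hM', hMM'⟩ := mem_supertile.1 (hMS rfl)
  obtain ⟨P, hP, j, rfl⟩ := mem_descendants_succ.1 hM'
  obtain ⟨X, hX, i, rfl⟩ := mem_descendants_succ.1 hP
  refine ⟨X, fun i' j' => hS𝒯 ⟨smul_prototile_mem_supertile
    (mem_descendants_succ.2 ⟨_, mem_descendants_succ.2 ⟨X, hX, i', rfl⟩, j', rfl⟩),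
    (i, j, i', j'), ?_⟩⟩
  dsimp only
  rw [← mul_smul_prototile_eq hMM']
  simp [mul_assoc]

/-- The kind of the edge at the vertex `2` into which a side of kind `k` is divided when the
midpoint of the long leg is a vertex. -/
def EdgeKind.halve : EdgeKind → EdgeKind
  | long => far
  | k => k

theorem EdgeKind.exists_occurs (V : Set ℂ) (M : Similarity ℂ) {k : EdgeKind} (hk : ¬ k.IsHalf) :
    ∃ l ∈ [k, k.halve], l.Occurs V M := by
  by_cases hV : M • (1 : ℂ) ∈ V
  · refine ⟨k.halve, by simp, ?_, fun _ => hV⟩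
    cases k <;> simp [halve]
  · exact ⟨k, by simp, fun _ => hV, fun h => absurd h hk⟩

/-- Eight sides of tiles of the twice dissected prototile that issue from a common vertex: each is
given by a tile and the kind of the side. -/
def spokes : Fin 8 → (Fin 5 × Fin 5) × EdgeKind :=
  ![((0, 1), .hyp), ((0, 1), .long), ((0, 2), .hyp), ((0, 3), .short), ((0, 4), .hyp),
    ((1, 0), .long), ((2, 0), .long), ((1, 1), .hyp)]

/-- The common vertex of the eight `spokes`. -/
def hub : GaussianRat :=
  child 0 • child 1 • 2

/-- The edge of kind `k` on the tile of the twice dissected prototile that carries the spoke `i`. -/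
def spokeEdge (i : Fin 8) (k : EdgeKind) : Sym2 GaussianRat :=
  k.ends.map ((child (spokes i).1.1 * child (spokes i).1.2) • ·)

theorem not_isHalf_spokes : ∀ i, ¬ (spokes i).2.IsHalf := by
  decide +kernel

theorem hub_mem_spokeEdge :
    ∀ i, ∀ k ∈ [(spokes i).2, (spokes i).2.halve], hub ∈ spokeEdge i k := by
  decide +kernel

theorem spokeEdge_ne : ∀ i j, i ≠ j → ∀ k ∈ [(spokes i).2, (spokes i).2.halve],
    ∀ l ∈ [(spokes j).2, (spokes j).2.halve], spokeEdge i k ≠ spokeEdge j l := by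
  decide +kernel

theorem IsPinwheelTiling.eight_le_chromaticIndex {𝒯 : Set Triangle} (h𝒯 : IsPinwheelTiling 𝒯) :
    8 ≤ (tilingGraph 𝒯).chromaticIndex := by
  obtain ⟨X, hX⟩ := h𝒯.exists_mul_child_mul_child_mem
  have hspoke (i : Fin 8) : ∃ k ∈ [(spokes i).2, (spokes i).2.halve],
      ∃ e ∈ (tilingGraph 𝒯).edgeSet, e.map (↑) = (spokeEdge i k).map fun q : GaussianRat =>
        X • (q : ℂ) := by
    obtain ⟨k, hk, hoccurs⟩ := EdgeKind.exists_occurs (vertices 𝒯)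
      (X * child (spokes i).1.1 * child (spokes i).1.2) (not_isHalf_spokes i)
    obtain ⟨e, he, hedge⟩ := h𝒯.exists_mem_edgeSet (hX _ _) hoccurs
    rw [mul_assoc, ← map_mul, edge_mul_coe] at hedge
    exact ⟨k, hk, e, he, hedge⟩
  choose k hk e he hedge using hspoke
  have hinj : Function.Injective fun q : GaussianRat => X • (q : ℂ) :=
    (MulAction.injective X).comp toComplex_injective
  refine SimpleGraph.le_chromaticNumber_of_pairwise_adj (n := 8) (by simp)
    (fun i : Fin 8 => ⟨e i, he i⟩) fun i j hij => lineGraph_adj_iff_map_coe.2 ?_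
  simp only [hedge]
  exact ⟨(Sym2.map.injective hinj).ne (spokeEdge_ne i j hij _ (hk i) _ (hk j)), X • (hub : ℂ),
    Sym2.mem_map.2 ⟨hub, hub_mem_spokeEdge i _ (hk i), rfl⟩,
    Sym2.mem_map.2 ⟨hub, hub_mem_spokeEdge j _ (hk j), rfl⟩⟩

end Pinwheel

theorem theorem6p7 (𝒯 : Set Pinwheel.Triangle) (h𝒯 : Pinwheel.IsPinwheelTiling 𝒯) :
    (Pinwheel.tilingGraph 𝒯).chromaticIndex = 8 :=
  le_antisymm h𝒯.colorable_lineGraph.chromaticNumber_le h𝒯.eight_le_chromaticIndex
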